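/- For $x>0$ let $s\mapsto\zeta_2(s,x)$ denote the analytic continuation to $\mathbb{C}\setminus\{1,2\}$ of the series $\sum_{m,n\ge 0}(x+m+n)^{-s}$, $\operatorname{Re}s>2$, and let $$\Gamma_2(x)=\exp\left(\left.\frac{\partial}{\partial s}\zeta_2(s,x)\right|_{s=0}\right)$$ be Barnes' double gamma function (with both periods equal to $1$). Let $\mathcal S_3$ be the class of generalized Stieltjes functions of order $3$, that is, of the functions $f:(0,\infty)\to\mathbb{R}$ of the form $$f(x)=\int_{[0,\infty)}\frac{d\mu(t)}{(x+t)^3}+c,\qquad x>0,$$ where $c\ge 0$ and $\mu$ is a positive measure on $[0,\infty)$ for which the integral converges for every $x>0$. Then the function $$R_{2,2}(x)=\log\Gamma_2(x)+\left(\tfrac12x^2-x+\tfrac5{12}\right)\log x-\tfrac34x^2+x,\qquad x>0,$$ which is a remainder in the asymptotic expansion of $\log\Gamma_2$, belongs to $\mathcal S_3$. -/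

import Mathlib

/-- The class `𝒮_lam` of generalized Stieltjes functions of order `lam`, for functions on `(0, ∞)`
(the values of `f` outside `(0, ∞)` play no role): `f x = ∫_{[0,∞)} (x + t)^{-lam} dμ(t) + c` for
`x > 0`, with a positive measure `μ` on `[0, ∞)` that makes the integral converge for every `x > 0`
and with a constant `c ≥ 0`. -/
def generalizedStieltjes (lam : ℝ) : Set (ℝ → ℝ) :=
  {f | ∃ (μ : MeasureTheory.Measure ℝ) (c : ℝ), 0 ≤ c ∧ ∀ x : ℝ, 0 < x →
    MeasureTheory.IntegrableOn (fun t : ℝ => 1 / (x + t) ^ lam) (Set.Ici 0) μ ∧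
    f x = (∫ t in Set.Ici (0 : ℝ), 1 / (x + t) ^ lam ∂μ) + c}

/-- `Z` is the analytic continuation to `ℂ \ {1, 2}` of the double zeta series
`∑_{m, n ≥ 0} (x + m + n)^{-s}`, `Re s > 2`. -/
def IsBarnesZetaTwo (x : ℝ) (Z : ℂ → ℂ) : Prop :=
  DifferentiableOn ℂ Z ({1, 2} : Set ℂ)ᶜ ∧
  ∀ s : ℂ, 2 < s.re →
    HasSum (fun p : ℕ × ℕ => 1 / ((x : ℂ) + (p.1 : ℂ) + (p.2 : ℂ)) ^ s) (Z s)

/-- Barnes' double zeta function `ζ₂(s, x)` with both periods equal to `1`, for `x > 0`, as a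
function of `s ∈ ℂ \ {1, 2}`: the continuation in the sense of `IsBarnesZetaTwo`, which exists and
is unique by the lemmas below. -/
noncomputable def barnesZetaTwo (x : ℝ) : ℂ → ℂ :=
  Classical.epsilon (IsBarnesZetaTwo x)

/-- Barnes' double gamma function `Γ₂(x) = exp (∂ζ₂(s, x)/∂s at s = 0)`, with both periods equal to
`1`, for `x > 0`. The derivative is a real number by `deriv_barnesZetaTwo_im`, so that taking its
real part loses nothing. -/
noncomputable def barnesGammaTwo (x : ℝ) : ℝ :=
  Real.exp (deriv (barnesZetaTwo x) 0).re

theorem hasSum_antidiagonal_lift (g : ℕ → ℂ) (a : ℂ)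
    (h : HasSum (fun k : ℕ => ((k : ℂ) + 1) * g k) a) :
    HasSum (fun p : ℕ × ℕ => g (p.1 + p.2)) a := by
  rw [← (Finset.HasAntidiagonal.sigmaAntidiagonalEquivProd (A := ℕ)).hasSum_iff]
  have key : ∀ (k : ℕ) (c : Finset.HasAntidiagonal.antidiagonal k),
      ((fun p : ℕ × ℕ => g (p.1 + p.2)) ∘ Finset.HasAntidiagonal.sigmaAntidiagonalEquivProd) ⟨k, c⟩ = g k := by
    intro k c
    have := c.2
    rw [Finset.HasAntidiagonal.mem_antidiagonal] at this
    simp [this]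
  have hcard : ∀ k : ℕ, Fintype.card (Finset.HasAntidiagonal.antidiagonal k) = k + 1 := by
    intro k; simp
  refine HasSum.sigma_of_hasSum h ?_ ?_
  · intro k
    simp_rw [key]
    have := hasSum_fintype (fun _ : Finset.HasAntidiagonal.antidiagonal k => g k)
    rw [Finset.sum_const, Finset.card_univ, hcard, nsmul_eq_mul] at this
    exact_mod_cast this
  · apply Summable.of_norm
    refine (summable_sigma_of_nonneg (fun _ => norm_nonneg _)).2 ⟨fun k => ?_, ?_⟩
    · exact (hasSum_fintype _).summable
    · refine h.summable.norm.congr fun k => ?_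
      simp_rw [key]
      rw [tsum_fintype, Finset.sum_const, Finset.card_univ, hcard, nsmul_eq_mul, norm_mul]
      congr 1
      rw [← Nat.cast_add_one, Complex.norm_natCast]

theorem exists_hurwitz_continuation {x : ℝ} (hx : 0 < x) :
    ∃ H : ℂ → ℂ, (∀ s, s ≠ 1 → DifferentiableAt ℂ H s) ∧
      ∀ s : ℂ, 1 < s.re → HasSum (fun n : ℕ => 1 / ((x : ℂ) + n) ^ s) (H s) := by
  obtain ⟨N, a, ha0, ha1, hxa⟩ : ∃ (N : ℕ) (a : ℝ), 0 < a ∧ a ≤ 1 ∧ x = a + N := by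
    refine ⟨⌈x⌉₊ - 1, x - ((⌈x⌉₊ - 1 : ℕ) : ℝ), ?_, ?_, by ring⟩
    · have h1 := Nat.ceil_lt_add_one hx.le
      have h2 : 1 ≤ ⌈x⌉₊ := Nat.one_le_iff_ne_zero.2 (Nat.ceil_pos.2 hx).ne'
      push_cast [h2]; linarith
    · have h1 := Nat.le_ceil x
      have h2 : 1 ≤ ⌈x⌉₊ := Nat.one_le_iff_ne_zero.2 (Nat.ceil_pos.2 hx).ne'
      push_cast [h2]; linarith
  refine ⟨fun s => HurwitzZeta.hurwitzZeta a s -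
    ∑ k ∈ Finset.range N, 1 / ((k : ℂ) + a) ^ s, fun s hs => ?_, fun s hs => ?_⟩
  · refine (HurwitzZeta.differentiableAt_hurwitzZeta _ hs).sub ?_
    refine DifferentiableAt.fun_sum fun k _ => ?_
    have hne : (k : ℂ) + a ≠ 0 := by
      have : (0 : ℝ) < k + a := by positivity
      exact_mod_cast this.ne'
    refine (differentiableAt_const _).div ?_ ?_
    · exact differentiableAt_id.const_cpow (Or.inl hne)
    · simp [Complex.cpow_eq_zero_iff, hne]
  · have h := HurwitzZeta.hasSum_hurwitzZeta_of_one_lt_re (a := a) ⟨ha0.le, ha1⟩ hs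
    have h2 := (hasSum_nat_add_iff' N).2 h
    refine h2.congr_fun fun n => ?_
    rw [hxa]
    push_cast
    congr 2
    ring

theorem exists_isBarnesZetaTwo {x : ℝ} (hx : 0 < x) : ∃ Z, IsBarnesZetaTwo x Z := by
  obtain ⟨H, hd, hs⟩ := exists_hurwitz_continuation hx
  refine ⟨fun s => H (s - 1) + (1 - x) * H s, ?_, ?_⟩
  · intro s hs'
    simp only [Set.mem_compl_iff, Set.mem_insert_iff, Set.mem_singleton_iff, not_or] at hs'
    have h1 : DifferentiableAt ℂ (fun s => H (s - 1)) s := by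
      refine DifferentiableAt.fun_comp' s (hd _ ?_) (by fun_prop)
      intro h
      exact hs'.2 (by linear_combination h)
    exact (h1.add ((hd s hs'.1).const_mul _)).differentiableWithinAt
  · intro s h2
    have h1 := hs (s - 1) (by simp; linarith)
    have h3 := (hs s (by linarith)).mul_left (1 - (x : ℂ))
    have h4 := hasSum_antidiagonal_lift (fun k => 1 / ((x : ℂ) + k) ^ s) _
      ((h1.add h3).congr_fun fun k => ?_)
    · refine h4.congr_fun fun p => ?_
      push_cast
      rw [add_assoc]
    · have hne : (x : ℂ) + k ≠ 0 := by
        have : (0 : ℝ) < x + k := by positivity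
        exact_mod_cast this.ne'
      have hne' : ((x : ℂ) + k) ^ s ≠ 0 := by simp [Complex.cpow_eq_zero_iff, hne]
      rw [Complex.cpow_sub _ _ hne, Complex.cpow_one]
      field_simp
      ring

theorem isBarnesZetaTwo_barnesZetaTwo {x : ℝ} (hx : 0 < x) :
    IsBarnesZetaTwo x (barnesZetaTwo x) :=
  Classical.epsilon_spec (exists_isBarnesZetaTwo hx)

theorem isBarnesZetaTwo_unique {x : ℝ} {Z W : ℂ → ℂ} (hZ : IsBarnesZetaTwo x Z)
    (hW : IsBarnesZetaTwo x W) : Set.EqOn Z W ({1, 2} : Set ℂ)ᶜ := by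
  have hc : ({1, 2} : Set ℂ).Countable := (Set.toFinite _).countable
  have ho : IsOpen ({1, 2} : Set ℂ)ᶜ := (Set.toFinite _).isClosed.isOpen_compl
  refine (hZ.1.analyticOnNhd ho).eqOn_of_preconnected_of_eventuallyEq (hW.1.analyticOnNhd ho)
    (hc.isConnected_compl_of_one_lt_rank (by simp [Complex.rank_real_complex])).isPreconnected
    (z₀ := 3) (by norm_num) ?_
  have : {s : ℂ | 2 < s.re} ∈ nhds (3 : ℂ) :=
    (isOpen_lt continuous_const Complex.continuous_re).mem_nhds (by norm_num)
  filter_upwards [this] with s hs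
  exact (hZ.2 s hs).unique (hW.2 s hs)

theorem deriv_barnesZetaTwo_im {x : ℝ} (hx : 0 < x) : (deriv (barnesZetaTwo x) 0).im = 0 := by
  have hZ := isBarnesZetaTwo_barnesZetaTwo hx
  have ho : IsOpen ({1, 2} : Set ℂ)ᶜ := (Set.toFinite _).isClosed.isOpen_compl
  have hW : IsBarnesZetaTwo x
      ((starRingEnd ℂ) ∘ barnesZetaTwo x ∘ (starRingEnd ℂ)) := by
    refine ⟨fun s hs => ?_, fun s hs => ?_⟩
    · have hs' : (starRingEnd ℂ) s ∈ ({1, 2} : Set ℂ)ᶜ := by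
        simp only [Set.mem_compl_iff, Set.mem_insert_iff, Set.mem_singleton_iff, not_or] at hs ⊢
        refine ⟨fun h => hs.1 ?_, fun h => hs.2 ?_⟩
        · simpa using congrArg (starRingEnd ℂ) h
        · have h' := congrArg (starRingEnd ℂ) h
          rwa [Complex.conj_conj, Complex.conj_ofNat] at h'
      have h := (hZ.1.differentiableAt (ho.mem_nhds hs')).hasDerivAt.conj_conj
      rw [Complex.conj_conj] at h
      exact h.differentiableAt.differentiableWithinAt
    · have h := (hZ.2 ((starRingEnd ℂ) s) (by simpa using hs)).map (starRingEnd ℂ)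
        Complex.continuous_conj
      refine h.congr_fun fun p => ?_
      have hp : (x : ℂ) + (p.1 : ℂ) + (p.2 : ℂ) = ((x + p.1 + p.2 : ℝ) : ℂ) := by push_cast; rfl
      have harg : ((x + p.1 + p.2 : ℝ) : ℂ).arg ≠ Real.pi := by
        rw [Complex.arg_ofReal_of_nonneg (by positivity)]
        exact Real.pi_pos.ne
      simp only [Function.comp_apply, map_div₀, map_one]
      rw [hp, Complex.cpow_conj _ _ harg, Complex.conj_conj, Complex.conj_ofReal]
  have h0 : (0 : ℂ) ∈ ({1, 2} : Set ℂ)ᶜ := by simp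
  have heq := (isBarnesZetaTwo_unique hW hZ).eventuallyEq_of_mem (ho.mem_nhds h0)
  have hd := heq.deriv_eq
  have h := (hZ.1.differentiableAt (ho.mem_nhds h0)).hasDerivAt.conj_conj
  rw [map_zero] at h
  rw [h.deriv] at hd
  exact Complex.conj_eq_iff_im.1 hd

/-- The defining formula of the double gamma function without the real part. -/
theorem ofReal_barnesGammaTwo {x : ℝ} (hx : 0 < x) :
    (barnesGammaTwo x : ℂ) = Complex.exp (deriv (barnesZetaTwo x) 0) := by
  rw [barnesGammaTwo, Complex.ofReal_exp]
  congr 1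
  apply Complex.ext
  · simp
  · simp [deriv_barnesZetaTwo_im hx]

/-! For Re s > 2, Γ(s) ζ₂(s, x) is the Mellin transform of e^{-xt} (1 - e^{-t})⁻². Removing from (1
- e^{-t})⁻² its expansion 1/t² + 1/t + 5/12 at t = 0 leaves `gammaKernel`, which is O(t), so its
part of the transform converges for Re s > -1; the removed terms contribute elementary functions of
s. Differentiation at s = 0 gives the elementary part of log Γ₂ and identifies the remainder as ∫₀^∞
e^{-xt} `gammaKernel t` / t dt (`log_barnesGammaTwo`).

Since (x + u)⁻³ = ∫₀^∞ e^{-(x+u)t} t²/2 dt, Tonelli's theorem reduces the claim to writing 2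
`gammaKernel t` / t³ as the Laplace transform of a positive measure. Partial fractions split
`gammaKernel` into terms `kernelTerm a`, a = 2π, 4π, … (`hasSum_kernelTerm`). For each of them the
Laplace inverse is the explicit `stieltjesDensity a`, and it is nonnegative because a ≥ 2π
(`stieltjesDensity_nonneg`). The measure is the sum of these densities, with c = 0. -/

theorem HasSum.of_eq {α β : Type*} [AddCommMonoid α] [TopologicalSpace α] {f g : β → α} {a b : α}
    (h : HasSum f a) (hf : ∀ k, g k = f k) (ha : b = a) : HasSum g b := by
  rw [funext hf, ha]
  exact h

/-! ### Partial fractions of the kernel -/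

/-- The `a`-th term of the partial fraction expansion of `gammaKernel`. -/
noncomputable def kernelTerm (a t : ℝ) : ℝ :=
  2 * t / (t ^ 2 + a ^ 2) + 2 * t ^ 2 * (t ^ 2 + 3 * a ^ 2) / (a ^ 2 * (t ^ 2 + a ^ 2) ^ 2)

/-- The function `(1 - e^{-t})⁻²` without the leading terms of its expansion at `t = 0`. -/
noncomputable def gammaKernel (t : ℝ) : ℝ :=
  1 / (1 - Real.exp (-t)) ^ 2 - 1 / t ^ 2 - 1 / t - 5 / 12

/-- The positive frequencies `2π, 4π, 6π, …`. -/
noncomputable def frequency (k : ℕ) : ℝ := 2 * Real.pi * (k + 1)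

theorem two_pi_le_frequency (k : ℕ) : 2 * Real.pi ≤ frequency k := by
  have : (0 : ℝ) ≤ k := k.cast_nonneg
  unfold frequency
  nlinarith [Real.pi_pos]

theorem frequency_pos (k : ℕ) : 0 < frequency k :=
  Real.two_pi_pos.trans_le (two_pi_le_frequency k)

theorem one_le_frequency (k : ℕ) : 1 ≤ frequency k := by
  linarith [two_pi_le_frequency k, Real.pi_gt_three]

theorem one_sub_exp_neg_pos {t : ℝ} (ht : 0 < t) : 0 < 1 - Real.exp (-t) := by
  have : Real.exp (-t) < 1 := (Real.exp_lt_one_iff).2 (by linarith)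
  linarith

/-- The point of the upper half plane whose nome is `e^{-t}`. -/
noncomputable def nomePoint (t : ℝ) (ht : 0 < t) : UpperHalfPlane :=
  ⟨((t / (2 * Real.pi) : ℝ) : ℂ) * Complex.I, by
    have : 0 < t / (2 * Real.pi) := by positivity
    rwa [Complex.im_ofReal_mul, Complex.I_im, mul_one]⟩

theorem coe_nomePoint {t : ℝ} (ht : 0 < t) :
    (nomePoint t ht : ℂ) = ((t / (2 * Real.pi) : ℝ) : ℂ) * Complex.I := rfl

theorem exp_two_pi_nomePoint {t : ℝ} (ht : 0 < t) :
    Complex.exp (2 * Real.pi * Complex.I * nomePoint t ht) = (Real.exp (-t) : ℂ) := by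
  rw [coe_nomePoint, Complex.ofReal_exp]
  congr 1
  have : (Real.pi : ℂ) ≠ 0 := by exact_mod_cast Real.pi_ne_zero
  push_cast
  field_simp
  linear_combination (t : ℂ) * Complex.I_sq

theorem sq_add_frequency_sq_ne_zero (t : ℝ) (k : ℕ) :
    (t : ℂ) ^ 2 + (frequency k : ℂ) ^ 2 ≠ 0 := by
  have := frequency_pos k
  have : (0 : ℝ) < t ^ 2 + frequency k ^ 2 := by positivity
  exact_mod_cast this.ne'

/-- The cotangent expansion at z = it/(2π), where e^{2πiz} = e^{-t}, multiplied by i/(2π). -/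
theorem hasSum_two_mul_div_sq_add_frequency_sq {t : ℝ} (ht : 0 < t) :
    HasSum (fun k : ℕ => 2 * t / (t ^ 2 + frequency k ^ 2))
      (1 / (1 - Real.exp (-t)) - 1 / 2 - 1 / t) := by
  have hz := UpperHalfPlane.coe_mem_integerComplement (nomePoint t ht)
  have h := (summable_cotTerm hz).hasSum
  rw [← cot_series_rep' hz, Complex.cot_pi_eq_exp_ratio, exp_two_pi_nomePoint ht] at h
  have h := h.mul_left (Complex.I / (2 * Real.pi))
  rw [← Complex.hasSum_ofReal]
  have hpi : (Real.pi : ℂ) ≠ 0 := by exact_mod_cast Real.pi_ne_zero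
  have ht' : (t : ℂ) ≠ 0 := by exact_mod_cast ht.ne'
  refine h.of_eq (fun k => ?_) ?_
  · have h1 := sq_add_frequency_sq_ne_zero t k
    have h2 := Complex.integerComplement_add_ne_zero hz (k + 1)
    have h3 := Complex.integerComplement_add_ne_zero hz (-(k + 1))
    rw [cotTerm_identity hz]
    push_cast at h2 h3 ⊢
    rw [← sub_eq_add_neg] at h3
    rw [coe_nomePoint] at *
    have h4 : (((t / (2 * Real.pi) : ℝ) : ℂ) * Complex.I + (k + 1)) *
      (((t / (2 * Real.pi) : ℝ) : ℂ) * Complex.I - (k + 1)) =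
        - ((t : ℂ) ^ 2 + (frequency k : ℂ) ^ 2) / (2 * Real.pi) ^ 2 := by
      unfold frequency
      push_cast
      field_simp
      linear_combination (t : ℂ) ^ 2 * Complex.I_sq
    rw [h4]
    push_cast
    field_simp
    linear_combination Complex.I_sq
  · have h1 : (1 : ℂ) - (Real.exp (-t) : ℂ) ≠ 0 := by exact_mod_cast (one_sub_exp_neg_pos ht).ne'
    rw [coe_nomePoint]
    push_cast at h1 ⊢
    field_simp
    ring

/-- Up to sign, the preceding expansion differentiated in t. It comes from Lipschitz's formula for ∑
(z + n)⁻² over the integers at z = it/(2π), which avoids differentiating a series. -/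
theorem hasSum_sq_sub_frequency_sq_div {t : ℝ} (ht : 0 < t) :
    HasSum (fun k : ℕ => 2 * (t ^ 2 - frequency k ^ 2) / (t ^ 2 + frequency k ^ 2) ^ 2)
      (Real.exp (-t) / (1 - Real.exp (-t)) ^ 2 - 1 / t ^ 2) := by
  have hz := UpperHalfPlane.coe_mem_integerComplement (nomePoint t ht)
  have hs : Summable fun n : ℤ => 1 / ((nomePoint t ht : ℂ) + n) ^ 2 := by
    simpa using (EisensteinSeries.linear_right_summable (nomePoint t ht) 1 (k := 2) le_rfl)
  have h := hs.hasSum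
  have he := EisensteinSeries.qExpansion_identity (k := 1) le_rfl (nomePoint t ht)
  rw [exp_two_pi_nomePoint ht] at he
  norm_num only at he
  have hq : ‖(Real.exp (-t) : ℂ)‖ < 1 := by
    rw [Complex.norm_real, Real.norm_of_nonneg (Real.exp_pos _).le]
    exact (Real.exp_lt_one_iff).2 (by linarith)
  simp only [pow_one] at he
  rw [tsum_coe_mul_geometric_of_norm_lt_one hq] at he
  rw [he] at h
  -- Folding the sum over ℤ onto ℕ counts n = 0 twice; dropping the first term removes both copies.
  have h := (hasSum_nat_add_iff' 1).2 h.nat_add_neg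
  have h := h.mul_left (-1 / (2 * Real.pi) ^ 2 : ℂ)
  rw [← Complex.hasSum_ofReal]
  have hpi : (Real.pi : ℂ) ≠ 0 := by exact_mod_cast Real.pi_ne_zero
  have ht' : (t : ℂ) ≠ 0 := by exact_mod_cast ht.ne'
  refine h.of_eq (fun k => ?_) ?_
  · have h1 := sq_add_frequency_sq_ne_zero t k
    have h2 := Complex.integerComplement_add_ne_zero hz (k + 1)
    have h3 := Complex.integerComplement_add_ne_zero hz (-(k + 1))
    push_cast at h2 h3 ⊢
    rw [coe_nomePoint] at *
    have h4 : (((t / (2 * Real.pi) : ℝ) : ℂ) * Complex.I + (k + 1)) *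
      (((t / (2 * Real.pi) : ℝ) : ℂ) * Complex.I + -(k + 1)) =
        - ((t : ℂ) ^ 2 + (frequency k : ℂ) ^ 2) / (2 * Real.pi) ^ 2 := by
      unfold frequency
      push_cast
      field_simp
      linear_combination (t : ℂ) ^ 2 * Complex.I_sq
    have h5 : (((t / (2 * Real.pi) : ℝ) : ℂ) * Complex.I + -(k + 1)) ^ 2 +
      (((t / (2 * Real.pi) : ℝ) : ℂ) * Complex.I + (k + 1)) ^ 2 =
        -2 * ((t : ℂ) ^ 2 - (frequency k : ℂ) ^ 2) / (2 * Real.pi) ^ 2 := by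
      unfold frequency
      push_cast
      field_simp
      linear_combination 2 * (t : ℂ) ^ 2 * Complex.I_sq
    rw [div_add_div _ _ (pow_ne_zero 2 h2) (pow_ne_zero 2 h3), ← mul_pow, h4, one_mul, mul_one,
      h5]
    field_simp
  · have h1 : (1 : ℂ) - (Real.exp (-t) : ℂ) ≠ 0 := by exact_mod_cast (one_sub_exp_neg_pos ht).ne'
    simp only [Finset.sum_range_one, coe_nomePoint]
    push_cast at h1 ⊢
    simp only [neg_zero, add_zero]
    have hI : Complex.I ≠ 0 := Complex.I_ne_zero
    field_simp
    simp only [Complex.I_sq]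
    push_cast
    ring

/-- Euler's ζ(2) = π²/6. Adding 2/a² to each term of the previous series cancels its value at t = 0,
which makes the terms of `gammaKernel` nonnegative; the sum 1/12 turns the constant -1/2 into -5/12.
-/
theorem hasSum_two_div_frequency_sq : HasSum (fun k : ℕ => 2 / frequency k ^ 2) (1 / 12) := by
  have h := ((hasSum_nat_add_iff' 1).2 hasSum_zeta_two).mul_left (2 / (2 * Real.pi) ^ 2)
  refine h.of_eq (fun k => ?_) ?_
  · unfold frequency
    push_cast
    rw [mul_pow]
    field_simp
  · have := Real.pi_ne_zero
    simp
    field_simp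
    norm_num

/-- With q = e^{-t}, (1 - q)⁻² = (1 - q)⁻¹ + q (1 - q)⁻², and both summands have been expanded. -/
theorem hasSum_kernelTerm {t : ℝ} (ht : 0 < t) :
    HasSum (fun k : ℕ => kernelTerm (frequency k) t) (gammaKernel t) := by
  refine (((hasSum_two_mul_div_sq_add_frequency_sq ht).add
    (hasSum_sq_sub_frequency_sq_div ht)).add hasSum_two_div_frequency_sq).of_eq (fun k => ?_) ?_
  · have := frequency_pos k
    have : (0 : ℝ) < t ^ 2 + frequency k ^ 2 := by positivity
    unfold kernelTerm
    field_simp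
    ring
  · have := (one_sub_exp_neg_pos ht).ne'
    unfold gammaKernel
    field_simp
    ring

theorem kernelTerm_nonneg (a : ℝ) {t : ℝ} (ht : 0 < t) : 0 ≤ kernelTerm a t := by
  unfold kernelTerm
  positivity

/-- The bound is summable over the frequencies and O(t) at 0, so it passes to `gammaKernel`. -/
theorem kernelTerm_le {a t : ℝ} (ha : 1 ≤ a) (ht : 0 < t) :
    kernelTerm a t ≤ 2 / a ^ 2 * (t + 3 * t ^ 2) := by
  have h0 : 0 < a := by linarith
  have h1 : 2 * t / (t ^ 2 + a ^ 2) ≤ 2 * t / a ^ 2 := by gcongr; nlinarith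
  have h2 : 2 * t ^ 2 * (t ^ 2 + 3 * a ^ 2) / (a ^ 2 * (t ^ 2 + a ^ 2) ^ 2) ≤
      6 * t ^ 2 / a ^ 2 := by
    rw [div_le_div_iff₀ (by positivity) (by positivity)]
    have : t ^ 2 + 3 * a ^ 2 ≤ 3 * (t ^ 2 + a ^ 2) ^ 2 := by
      have : 1 ≤ t ^ 2 + a ^ 2 := by nlinarith
      nlinarith
    calc _ = 2 * t ^ 2 * a ^ 2 * (t ^ 2 + 3 * a ^ 2) := by ring
      _ ≤ 2 * t ^ 2 * a ^ 2 * (3 * (t ^ 2 + a ^ 2) ^ 2) := by gcongr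
      _ = _ := by ring
  unfold kernelTerm
  calc _ ≤ _ := add_le_add h1 h2
    _ = _ := by ring

theorem gammaKernel_nonneg {t : ℝ} (ht : 0 < t) : 0 ≤ gammaKernel t :=
  (hasSum_kernelTerm ht).nonneg fun _ => kernelTerm_nonneg _ ht

theorem gammaKernel_le {t : ℝ} (ht : 0 < t) : gammaKernel t ≤ t + t ^ 2 := by
  have := hasSum_le (fun k => kernelTerm_le (one_le_frequency k) ht) (hasSum_kernelTerm ht)
    (hasSum_two_div_frequency_sq.mul_right _)
  nlinarith

section

open Real MeasureTheory Set Filter Topology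

/-! ### Laplace inversion of the terms and positivity of the densities -/

/-- The density whose Laplace transform is `2 * kernelTerm a t / t ^ 3`. -/
noncomputable def stieltjesDensity (a u : ℝ) : ℝ :=
  4 / a ^ 3 * ((a * u - sin (a * u)) + (3 * (1 - cos (a * u)) - a * u * sin (a * u)) / a)

/-- In terms of w = v/2 this is w ≤ tan w on [0, π/2). -/
theorem mul_sin_le {v : ℝ} (h0 : 0 ≤ v) (hv : v < π) : v * sin v ≤ 2 * (1 - cos v) := by
  obtain ⟨w, rfl⟩ : ∃ w, v = 2 * w := ⟨v / 2, by ring⟩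
  have hc : 0 < cos w := cos_pos_of_mem_Ioo ⟨by linarith, by linarith⟩
  have ht : w ≤ tan w := le_tan (by linarith) (by linarith)
  rw [tan_eq_sin_div_cos, le_div_iff₀ hc] at ht
  have hs : 0 ≤ sin w := sin_nonneg_of_nonneg_of_le_pi (by linarith) (by linarith)
  rw [sin_two_mul, cos_two_mul, cos_sq']
  nlinarith [mul_le_mul_of_nonneg_right ht hs]

/-- With v = au, only -v sin v / a can be negative. For small v it is absorbed by 3(1 - cos v); for
larger v it is at least -v/6, since a ≥ 6, and v - sin v outweighs it. -/
theorem stieltjesDensity_nonneg {a u : ℝ} (ha : 2 * π ≤ a) (hu : 0 ≤ u) :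
    0 ≤ stieltjesDensity a u := by
  have ha3 : 6 ≤ a := by linarith [pi_gt_three]
  have ha0 : 0 < a := by linarith
  unfold stieltjesDensity
  set v := a * u with hv
  have hv0 : 0 ≤ v := by positivity
  have hs := sin_le hv0
  refine mul_nonneg (by positivity) ?_
  -- Any threshold between 6/5 and π would do: v - 1 ≥ v/6 is needed above it, `mul_sin_le` below
  -- it.
  rcases lt_or_ge v 2 with h | h
  · have h1 := mul_sin_le hv0 (by linarith [pi_gt_three])
    have h2 := cos_le_one v
    have : 0 ≤ (3 * (1 - cos v) - v * sin v) / a := by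
      apply div_nonneg _ ha0.le
      linarith
    linarith
  · have h1 := cos_le_one v
    have h2 := sin_le_one v
    have : -(v / 6) ≤ (3 * (1 - cos v) - v * sin v) / a := by
      rw [le_div_iff₀ ha0]
      nlinarith
    linarith

theorem hasDerivAt_exp_neg_mul_const (t u : ℝ) :
    HasDerivAt (fun u => exp (-(t * u))) (-t * exp (-(t * u))) u := by
  have := ((hasDerivAt_id u).const_mul t).neg.exp
  simpa [mul_comm] using this

theorem tendsto_exp_neg_mul_mul_of_isBigO {t : ℝ} (ht : 0 < t) {f : ℝ → ℝ}
    (hf : f =O[atTop] (fun u : ℝ => u)) :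
    Tendsto (fun u => exp (-(t * u)) * f u) atTop (𝓝 0) := by
  refine ((Asymptotics.isBigO_refl (fun u : ℝ => exp (-(t * u))) atTop).mul hf).trans_tendsto ?_
  have h := tendsto_rpow_mul_exp_neg_mul_atTop_nhds_zero 1 t ht
  refine h.congr fun u => ?_
  rw [rpow_one, neg_mul, mul_comm]

/-- The second factor of the primitive of `e^{-tu} * stieltjesDensity a u`. -/
noncomputable def densityPrimitive (a t u : ℝ) : ℝ :=
  4 / a ^ 3 * (-(a * (u / t + 1 / t ^ 2)) + (t * sin (a * u) + a * cos (a * u)) / (t ^ 2 + a ^ 2) +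
    (-(3 / t) - 3 * (a * sin (a * u) - t * cos (a * u)) / (t ^ 2 + a ^ 2) +
      a * (u * (t * sin (a * u) + a * cos (a * u)) / (t ^ 2 + a ^ 2) +
        (t * (t * sin (a * u) + a * cos (a * u)) - a * (a * sin (a * u) - t * cos (a * u))) /
          (t ^ 2 + a ^ 2) ^ 2)) / a)

theorem hasDerivAt_densityPrimitive {a t : ℝ} (ha : 0 < a) (ht : 0 < t) (u : ℝ) :
    HasDerivAt (fun u => exp (-(t * u)) * densityPrimitive a t u)
      (exp (-(t * u)) * stieltjesDensity a u) u := by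
  have hs : HasDerivAt (fun u => sin (a * u)) (a * cos (a * u)) u := by
    simpa [mul_comm] using ((hasDerivAt_id u).const_mul a).sin
  have hc : HasDerivAt (fun u => cos (a * u)) (-(a * sin (a * u))) u := by
    simpa [mul_comm] using ((hasDerivAt_id u).const_mul a).cos
  have hA := (hs.const_mul t).add (hc.const_mul a)
  have hB := (hs.const_mul a).sub (hc.const_mul t)
  have hu := hasDerivAt_id u
  have h := (hasDerivAt_exp_neg_mul_const t u).mul ((((((hu.div_const t).add_const
    (1 / t ^ 2)).const_mul a).neg.add (hA.div_const (t ^ 2 + a ^ 2))).add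
      ((((hB.const_mul 3).div_const (t ^ 2 + a ^ 2)).const_sub (-(3 / t))).add
        ((((hu.mul hA).div_const (t ^ 2 + a ^ 2)).add (((hA.const_mul t).sub
          (hB.const_mul a)).div_const ((t ^ 2 + a ^ 2) ^ 2))).const_mul a) |>.div_const a)).const_mul
            (4 / a ^ 3))
  refine h.congr_deriv ?_
  unfold stieltjesDensity
  simp only [Pi.add_apply, Pi.sub_apply, Pi.mul_apply, Pi.neg_apply, id_eq]
  field_simp
  ring

/-- Linear growth loses to e^{-tu}, so the primitive vanishes at infinity and the Laplace transform
is -`densityPrimitive a t 0`. -/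
theorem isBigO_densityPrimitive (a t : ℝ) :
    densityPrimitive a t =O[atTop] (fun u : ℝ => u) := by
  have hc (c : ℝ) : (fun _ : ℝ => c) =O[atTop] (fun u : ℝ => u) :=
    (Asymptotics.isLittleO_const_id_atTop c).isBigO
  have hb {f : ℝ → ℝ} (hf : ∀ u, |f u| ≤ 1) : f =O[atTop] (fun _ : ℝ => (1 : ℝ)) :=
    Asymptotics.IsBigO.of_bound 1 (Eventually.of_forall fun u => by simpa using hf u)
  have hsin := hb fun u => abs_sin_le_one (a * u)
  have hcos := hb fun u => abs_cos_le_one (a * u)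
  have hA := (hsin.const_mul_left t).add (hcos.const_mul_left a)
  have hB := (hsin.const_mul_left a).sub (hcos.const_mul_left t)
  have hu := Asymptotics.isBigO_refl (fun u : ℝ => u) atTop
  have huA := hu.mul hA
  simp only [mul_one] at huA
  have hd {f : ℝ → ℝ} (hf : f =O[atTop] (fun u : ℝ => u)) (c : ℝ) :
      (fun u => f u / c) =O[atTop] (fun u : ℝ => u) := by
    simpa only [div_eq_inv_mul] using hf.const_mul_left c⁻¹
  have hA' := hA.trans (hc 1)
  have hB' := hB.trans (hc 1)
  unfold densityPrimitive
  exact (((((hd hu t).add (hc _)).const_mul_left a).neg_left.add (hd hA' _)).add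
    (hd (((hc _).sub (hd (hB'.const_mul_left 3) _)).add (((hd huA _).add
      (hd ((hA'.const_mul_left t).sub (hB'.const_mul_left a)) _)).const_mul_left a)) a)).const_mul_left
        _

theorem integrableOn_exp_mul_stieltjesDensity {a t : ℝ} (ha : 2 * π ≤ a) (ht : 0 < t) :
    IntegrableOn (fun u => exp (-(t * u)) * stieltjesDensity a u) (Ioi 0) :=
  integrableOn_Ioi_deriv_of_nonneg'
    (fun u _ => hasDerivAt_densityPrimitive (two_pi_pos.trans_le ha) ht u)
    (fun _ hu => mul_nonneg (exp_pos _).le (stieltjesDensity_nonneg ha (le_of_lt hu)))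
    (tendsto_exp_neg_mul_mul_of_isBigO ht (isBigO_densityPrimitive a t))

theorem integral_exp_mul_stieltjesDensity {a t : ℝ} (ha : 2 * π ≤ a) (ht : 0 < t) :
    ∫ u in Ioi 0, exp (-(t * u)) * stieltjesDensity a u = 2 * kernelTerm a t / t ^ 3 := by
  have ha0 : 0 < a := two_pi_pos.trans_le ha
  rw [integral_Ioi_of_hasDerivAt_of_nonneg'
    (fun u _ => hasDerivAt_densityPrimitive ha0 ht u)
    (fun _ hu => mul_nonneg (exp_pos _).le (stieltjesDensity_nonneg ha (le_of_lt hu)))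
    (tendsto_exp_neg_mul_mul_of_isBigO ht (isBigO_densityPrimitive a t))]
  unfold densityPrimitive kernelTerm
  simp only [mul_zero, neg_zero, exp_zero, sin_zero, cos_zero]
  field_simp
  ring

theorem lintegral_exp_mul_stieltjesDensity {a t : ℝ} (ha : 2 * π ≤ a) (ht : 0 < t) :
    ∫⁻ u in Ioi 0, ENNReal.ofReal (exp (-(t * u)) * stieltjesDensity a u) =
      ENNReal.ofReal (2 * kernelTerm a t / t ^ 3) := by
  rw [← integral_exp_mul_stieltjesDensity ha ht,
    ofReal_integral_eq_lintegral_ofReal (integrableOn_exp_mul_stieltjesDensity ha ht)]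
  exact (ae_restrict_mem measurableSet_Ioi).mono fun _ hu =>
    mul_nonneg (exp_pos _).le (stieltjesDensity_nonneg ha (le_of_lt hu))

/-! ### Mellin transforms and the double zeta function -/

theorem hasSum_exp_neg_mul {x t : ℝ} (ht : 0 < t) :
    HasSum (fun p : ℕ × ℕ => (1 : ℂ) * (exp (-(x + p.1 + p.2) * t) : ℝ))
      ((exp (-(x * t)) / (1 - exp (-t)) ^ 2 : ℝ) : ℂ) := by
  have hq : ‖exp (-t)‖ < 1 := by
    rw [norm_of_nonneg (exp_pos _).le]
    exact exp_lt_one_iff.2 (by linarith)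
  -- ∑ k qᵏ + ∑ qᵏ = ∑ (k + 1) qᵏ, where k + 1 counts the pairs with m + n = k.
  have h := ((hasSum_coe_mul_geometric_of_norm_lt_one hq).add
    (hasSum_geometric_of_norm_lt_one hq)).mul_left (exp (-(x * t)))
  have hne := (one_sub_exp_neg_pos ht).ne'
  have h' := Complex.hasSum_ofReal.2 h
  refine (hasSum_antidiagonal_lift (fun k => ((exp (-(x + k) * t) : ℝ) : ℂ)) _
    (h'.of_eq (fun k => ?_) ?_)).of_eq (fun p => ?_) rfl
  · have : exp (-(x + k) * t) = exp (-(x * t)) * exp (-t) ^ k := by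
      rw [← exp_nat_mul, ← exp_add]
      ring_nf
    rw [this]
    push_cast
    ring
  · congr 1
    field_simp
    ring
  · rw [one_mul]
    push_cast
    ring_nf

/-- The exponential `e^{-xt}` as a complex valued function of `t`. -/
noncomputable def expNegMul (x t : ℝ) : ℂ := ((exp (-(x * t)) : ℝ) : ℂ)

/-- The function whose Mellin transform at `0` is the remainder of `log Γ₂`. -/
noncomputable def remainderKernel (x t : ℝ) : ℂ := ((exp (-(x * t)) * gammaKernel t : ℝ) : ℂ)

theorem hasMellin_expNegMul {x : ℝ} (hx : 0 < x) {s : ℂ} (hs : 0 < s.re) :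
    HasMellin (expNegMul x) s ((x : ℂ) ^ (-s) * Complex.Gamma s) := by
  have he : expNegMul x = fun t => (fun u : ℝ => ((exp (-u) : ℝ) : ℂ)) (x * t) := rfl
  have hc : MellinConvergent (fun u : ℝ => ((exp (-u) : ℝ) : ℂ)) s := by
    refine (Complex.GammaIntegral_convergent hs).congr_fun (fun t _ => ?_) measurableSet_Ioi
    simp only [smul_eq_mul]
    rw [mul_comm]
  refine ⟨?_, ?_⟩
  · rw [he]
    exact (MellinConvergent.comp_mul_left hx).2 hc
  · rw [he, mellin_comp_mul_left (fun u : ℝ => ((exp (-u) : ℝ) : ℂ)) s hx, Complex.Gamma_eq_integral hs,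
      Complex.GammaIntegral_eq_mellin, smul_eq_mul]

theorem hasMellin_cpow_mul_expNegMul {x : ℝ} (hx : 0 < x) {s a : ℂ} (hs : 0 < (s + a).re) :
    HasMellin (fun t : ℝ => (t : ℂ) ^ a • expNegMul x t) s
      ((x : ℂ) ^ (-(s + a)) * Complex.Gamma (s + a)) :=
  ⟨MellinConvergent.cpow_smul.2 (hasMellin_expNegMul hx hs).1,
    by rw [mellin_cpow_smul, (hasMellin_expNegMul hx hs).2]⟩

theorem norm_remainderKernel_le (x : ℝ) {t : ℝ} (ht : 0 < t) :
    ‖remainderKernel x t‖ ≤ exp (-(x * t)) * (t + t ^ 2) := by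
  have h := gammaKernel_nonneg ht
  rw [remainderKernel, Complex.norm_real, norm_of_nonneg (by positivity)]
  gcongr
  exact gammaKernel_le ht

theorem continuousOn_gammaKernel : ContinuousOn gammaKernel (Ioi 0) := by
  intro t ht
  have h1 := (one_sub_exp_neg_pos ht).ne'
  have h2 : t ≠ 0 := ne_of_gt ht
  refine ContinuousAt.continuousWithinAt ?_
  unfold gammaKernel
  fun_prop (disch := positivity)

theorem continuousOn_remainderKernel (x : ℝ) : ContinuousOn (remainderKernel x) (Ioi 0) := by
  refine Complex.continuous_ofReal.comp_continuousOn (ContinuousOn.mul ?_ continuousOn_gammaKernel)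
  fun_prop

theorem isBigO_remainderKernel_atTop {x : ℝ} (hx : 0 < x) :
    remainderKernel x =O[atTop] fun t => exp (-(x / 2) * t) := by
  have h1 : (fun t : ℝ => t + t ^ 2) =O[atTop] fun t => exp (x / 2 * t) := by
    simpa using ((isLittleO_pow_exp_pos_mul_atTop 1 (half_pos hx)).add
      (isLittleO_pow_exp_pos_mul_atTop 2 (half_pos hx))).isBigO
  have h2 : remainderKernel x =O[atTop] fun t => exp (-(x * t)) * (t + t ^ 2) := by
    refine Asymptotics.IsBigO.of_bound 1 ?_
    filter_upwards [eventually_gt_atTop 0] with t ht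
    rw [one_mul, norm_of_nonneg (by positivity)]
    exact norm_remainderKernel_le x ht
  refine (h2.trans ((Asymptotics.isBigO_refl _ _).mul h1)).congr_right fun t => ?_
  rw [← exp_add]
  ring_nf

/-- The exponent is written as -b with b = -1, since a bound O(t^{-b}) at 0 gives Mellin convergence
for Re s > b; the point s = 0 is then included. -/
theorem isBigO_remainderKernel_zero {x : ℝ} (hx : 0 < x) :
    remainderKernel x =O[𝓝[>] 0] fun t => t ^ (-(-1) : ℝ) := by
  refine Asymptotics.IsBigO.of_bound 2 ?_
  filter_upwards [Ioo_mem_nhdsGT (zero_lt_one' ℝ)] with t ht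
  have h := norm_remainderKernel_le x ht.1
  have h1 : exp (-(x * t)) ≤ 1 := exp_le_one_iff.2 (by nlinarith [mul_pos hx ht.1])
  rw [neg_neg, rpow_one, norm_of_nonneg ht.1.le]
  have h2 : 0 ≤ t + t ^ 2 := by nlinarith [ht.1]
  nlinarith [ht.1, ht.2, mul_le_mul_of_nonneg_right h1 h2]

theorem mellinConvergent_remainderKernel {x : ℝ} (hx : 0 < x) {s : ℂ} (hs : -1 < s.re) :
    MellinConvergent (remainderKernel x) s :=
  mellinConvergent_of_isBigO_rpow_exp (half_pos hx)
    ((continuousOn_remainderKernel x).locallyIntegrableOn measurableSet_Ioi)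
    (isBigO_remainderKernel_atTop hx) (isBigO_remainderKernel_zero hx) hs

theorem differentiableAt_mellin_remainderKernel {x : ℝ} (hx : 0 < x) {s : ℂ} (hs : -1 < s.re) :
    DifferentiableAt ℂ (mellin (remainderKernel x)) s :=
  mellin_differentiableAt_of_isBigO_rpow_exp (half_pos hx)
    ((continuousOn_remainderKernel x).locallyIntegrableOn measurableSet_Ioi)
    (isBigO_remainderKernel_atTop hx) (isBigO_remainderKernel_zero hx) hs

theorem mellin_exp_div_one_sub_exp_sq {x : ℝ} (hx : 0 < x) {s : ℂ} (hs : 2 < s.re) :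
    mellin (fun t => ((exp (-(x * t)) / (1 - exp (-t)) ^ 2 : ℝ) : ℂ)) s =
      mellin (remainderKernel x) s + (x : ℂ) ^ (-(s + (-2))) * Complex.Gamma (s + (-2)) +
        (x : ℂ) ^ (-(s + (-1))) * Complex.Gamma (s + (-1)) +
          (5 / 12 : ℂ) * ((x : ℂ) ^ (-s) * Complex.Gamma s) := by
  have h0 := mellinConvergent_remainderKernel hx (s := s) (by linarith)
  have h1 := hasMellin_cpow_mul_expNegMul hx (s := s) (a := -2) (by simp; linarith)
  have h2 := hasMellin_cpow_mul_expNegMul hx (s := s) (a := -1) (by simp; linarith)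
  have h3 := hasMellin_expNegMul hx (s := s) (by linarith)
  have h4 := hasMellin_const_smul h3.1 (5 / 12 : ℂ)
  have h5 := hasMellin_add h0 h1.1
  have h6 := hasMellin_add h5.1 h2.1
  have h7 := hasMellin_add h6.1 h4.1
  rw [h6.2, h5.2, h4.2, h1.2, h2.2, h3.2, smul_eq_mul] at h7
  rw [← h7.2]
  refine setIntegral_congr_fun measurableSet_Ioi fun t ht => ?_
  have ht' : (t : ℂ) ≠ 0 := by exact_mod_cast (ne_of_gt ht)
  simp only [remainderKernel, expNegMul, gammaKernel, smul_eq_mul]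
  rw [Complex.cpow_neg, Complex.cpow_neg, Complex.cpow_one, Complex.cpow_ofNat]
  push_cast
  ring

/-- Termwise integration of the double geometric series for e^{-xt} (1 - e^{-t})⁻². -/
theorem gamma_mul_barnesZetaTwo {x : ℝ} (hx : 0 < x) {s : ℂ} (hs : 2 < s.re) :
    Complex.Gamma s * barnesZetaTwo x s =
      mellin (fun t => ((exp (-(x * t)) / (1 - exp (-t)) ^ 2 : ℝ) : ℂ)) s := by
  have hZ := (isBarnesZetaTwo_barnesZetaTwo hx).2 s hs
  have hp : ∀ p : ℕ × ℕ, 0 < x + p.1 + p.2 := fun p => by positivity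
  have h := hasSum_mellin (a := fun _ : ℕ × ℕ => (1 : ℂ)) (p := fun p => x + p.1 + p.2) (s := s)
    (F := fun t => ((exp (-(x * t)) / (1 - exp (-t)) ^ 2 : ℝ) : ℂ))
    (fun p => Or.inr (hp p)) (by linarith) (fun t ht => hasSum_exp_neg_mul ht) ?_
  · refine (hZ.mul_left (Complex.Gamma s)).unique (h.of_eq (fun p => ?_) rfl)
    push_cast
    ring
  · refine hZ.summable.norm.congr fun p => ?_
    have : (x : ℂ) + p.1 + p.2 = ((x + p.1 + p.2 : ℝ) : ℂ) := by push_cast; rfl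
    rw [norm_div, this, Complex.norm_cpow_eq_rpow_re_of_pos (hp p)]

/-! ### Continuation to s = 0 and the integral formula for log Γ₂ -/

/-- The double zeta function near `s = 0`, in terms of a convergent Mellin transform. -/
noncomputable def mellinZetaTwo (x : ℝ) (s : ℂ) : ℂ :=
  s * ((Complex.Gamma (s + 1))⁻¹ * mellin (remainderKernel x) s) +
    (x : ℂ) ^ 2 * ((x : ℂ) ^ (-s) / ((s - 1) * (s - 2))) + x * ((x : ℂ) ^ (-s) / (s - 1)) +
      5 / 12 * (x : ℂ) ^ (-s)

/-- Division by Γ(s), using Γ(s) = Γ(s + 1)/s = (s - 1) Γ(s - 1) = (s - 1)(s - 2) Γ(s - 2). -/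
theorem barnesZetaTwo_eq_mellinZetaTwo {x : ℝ} (hx : 0 < x) {s : ℂ} (hs : 2 < s.re) :
    barnesZetaTwo x s = mellinZetaTwo x s := by
  have hG : Complex.Gamma s ≠ 0 := Complex.Gamma_ne_zero_of_re_pos (by linarith)
  have hne (r : ℝ) (hr : r ≤ 2) : s - r ≠ 0 := fun h => by
    rw [sub_eq_zero] at h
    rw [h, Complex.ofReal_re] at hs
    linarith
  have h0 := hne 0 (by norm_num)
  have h1 := hne 1 (by norm_num)
  have h2 := hne 2 (by norm_num)
  push_cast at h0 h1 h2
  rw [sub_zero] at h0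
  have hx' : (x : ℂ) ≠ 0 := by exact_mod_cast hx.ne'
  have e1 := Complex.Gamma_add_one (s + (-1)) (by rwa [← sub_eq_add_neg])
  have e2 := Complex.Gamma_add_one (s + (-2)) (by rwa [← sub_eq_add_neg])
  rw [neg_add_cancel_right] at e1
  rw [show s + -2 + 1 = s + -1 by ring] at e2
  have hG2 : Complex.Gamma (s + (-2)) ≠ 0 :=
    Complex.Gamma_ne_zero_of_re_pos (by simp; linarith)
  have c1 : (x : ℂ) ^ (-(s + (-1))) = x * (x : ℂ) ^ (-s) := by
    rw [show -(s + (-1)) = 1 + -s by ring, Complex.cpow_add _ _ hx', Complex.cpow_one]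
  have c2 : (x : ℂ) ^ (-(s + (-2))) = (x : ℂ) ^ 2 * (x : ℂ) ^ (-s) := by
    rw [show -(s + (-2)) = 2 + -s by ring, Complex.cpow_add _ _ hx', Complex.cpow_ofNat]
  apply mul_left_cancel₀ hG
  rw [gamma_mul_barnesZetaTwo hx hs, mellin_exp_div_one_sub_exp_sq hx hs, mellinZetaTwo,
    Complex.Gamma_add_one s h0, c1, c2]
  rw [sub_eq_add_neg] at h1 h2
  rw [sub_eq_add_neg, sub_eq_add_neg]
  rw [e1, e2]
  field_simp

theorem differentiableAt_inv_Gamma_mul_mellin {x : ℝ} (hx : 0 < x) {s : ℂ} (hs : -1 < s.re) :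
    DifferentiableAt ℂ
      (fun s => (Complex.Gamma (s + 1))⁻¹ * mellin (remainderKernel x) s) s :=
  ((Complex.differentiable_one_div_Gamma.comp (differentiable_id.add_const 1)) s).mul
    (differentiableAt_mellin_remainderKernel hx hs)

theorem hasDerivAt_cpow_neg {x : ℝ} (hx : 0 < x) (s : ℂ) :
    HasDerivAt (fun s : ℂ => (x : ℂ) ^ (-s)) (-((x : ℂ) ^ (-s) * Complex.log x)) s := by
  have := (hasDerivAt_neg s).const_cpow (c := (x : ℂ)) (Or.inl (by exact_mod_cast hx.ne'))
  simpa using this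

theorem differentiableAt_mellinZetaTwo {x : ℝ} (hx : 0 < x) {s : ℂ} (hs : -1 < s.re)
    (h1 : s ≠ 1) (h2 : s ≠ 2) : DifferentiableAt ℂ (mellinZetaTwo x) s := by
  have hG := differentiableAt_inv_Gamma_mul_mellin hx hs
  have hp := (hasDerivAt_cpow_neg hx s).differentiableAt
  have h1' := sub_ne_zero.2 h1
  have h2' := sub_ne_zero.2 h2
  have hd (c : ℂ) : DifferentiableAt ℂ (fun s : ℂ => s - c) s := differentiableAt_id.sub_const c
  exact (((differentiableAt_id.mul hG).add ((hp.div ((hd 1).mul (hd 2))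
    (mul_ne_zero h1' h2')).const_mul _)).add ((hp.div (hd 1) h1').const_mul _)).add
      (hp.const_mul _)

/-- The identity theorem on a connected open set that contains 0, meets Re s > 2 and avoids the
poles. -/
theorem eventually_barnesZetaTwo_eq {x : ℝ} (hx : 0 < x) :
    barnesZetaTwo x =ᶠ[𝓝 0] mellinZetaTwo x := by
  -- `V` lies above the real axis, so it links the unit disc to the half plane Re s > 2 while
  -- passing over 1 and 2.
  set V : Set ℂ := Complex.re ⁻¹' Ioi (-1) ∩ Complex.im ⁻¹' Ioi 0 with hV
  set H : Set ℂ := Complex.re ⁻¹' Ioi 2 with hH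
  have hVo : IsOpen V := (isOpen_Ioi.preimage Complex.continuous_re).inter
    (isOpen_Ioi.preimage Complex.continuous_im)
  have hHo : IsOpen H := isOpen_Ioi.preimage Complex.continuous_re
  have hVc : IsPreconnected V := (((convex_Ioi (-1 : ℝ)).linear_preimage Complex.reLm).inter
    ((convex_Ioi (0 : ℝ)).linear_preimage Complex.imLm)).isPreconnected
  have hHc : IsPreconnected H := ((convex_Ioi (2 : ℝ)).linear_preimage Complex.reLm).isPreconnected
  have hBc : IsPreconnected (Metric.ball (0 : ℂ) 1) := (convex_ball _ _).isPreconnected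
  set U := (V ∪ H) ∪ Metric.ball (0 : ℂ) 1 with hU
  have hUo : IsOpen U := (hVo.union hHo).union Metric.isOpen_ball
  have hUc : IsPreconnected U := by
    refine (hVc.union (3 + Complex.I) ?_ ?_ hHc).union (Complex.I / 2) ?_ ?_ hBc
    · simp [hV]; norm_num
    · simp [hH]; norm_num
    · left; simp [hV]
    · simp only [Metric.mem_ball, dist_zero_right, norm_div, Complex.norm_I, Complex.norm_ofNat]
      norm_num
  have hball : ∀ s ∈ Metric.ball (0 : ℂ) 1, |s.re| < 1 := fun s hs =>
    (Complex.abs_re_le_norm s).trans_lt (by simpa using hs)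
  have hU1 : ∀ s ∈ U, -1 < s.re := by
    rintro s ((hs | hs) | hs)
    · exact hs.1
    · have : 2 < s.re := hs
      linarith
    · exact (abs_lt.1 (hball s hs)).1
  have hU2 : ∀ s ∈ U, s ≠ 1 ∧ s ≠ 2 := by
    rintro s ((hs | hs) | hs)
    · have h := hs.2
      constructor <;> rintro rfl <;> simp at h
    · have h : 2 < s.re := hs
      constructor <;> rintro rfl <;> norm_num at h
    · have h := hball s hs
      constructor <;> rintro rfl <;> norm_num at h
  have hZ : DifferentiableOn ℂ (barnesZetaTwo x) U :=
    (isBarnesZetaTwo_barnesZetaTwo hx).1.mono fun s hs => by simpa using hU2 s hs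
  have hW : DifferentiableOn ℂ (mellinZetaTwo x) U := fun s hs =>
    (differentiableAt_mellinZetaTwo hx (hU1 s hs) (hU2 s hs).1 (hU2 s hs).2).differentiableWithinAt
  have h3 : (3 : ℂ) ∈ H := by simp [hH]; norm_num
  have heq : EqOn (barnesZetaTwo x) (mellinZetaTwo x) U :=
    (hZ.analyticOnNhd hUo).eqOn_of_preconnected_of_eventuallyEq (hW.analyticOnNhd hUo) hUc
      (z₀ := 3) (Or.inl (Or.inr h3)) (by
        filter_upwards [hHo.mem_nhds h3] with s hs
        exact barnesZetaTwo_eq_mellinZetaTwo hx hs)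
  exact heq.eventuallyEq_of_mem (hUo.mem_nhds (Or.inr (by simp)))

/-- The factor s in front of the Mellin transform vanishes at 0, so only the value of the transform
there survives, with 1/Γ(1) = 1. -/
theorem hasDerivAt_mellinZetaTwo_zero {x : ℝ} (hx : 0 < x) :
    HasDerivAt (mellinZetaTwo x) (mellin (remainderKernel x) 0 +
      x ^ 2 * (3 / 4 - Complex.log x / 2) + x * (Complex.log x - 1) - 5 / 12 * Complex.log x) 0 := by
  have hG := (differentiableAt_inv_Gamma_mul_mellin hx (s := 0) (by simp)).hasDerivAt
  have hp := hasDerivAt_cpow_neg hx 0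
  have h1 := (hasDerivAt_id (0 : ℂ)).sub_const 1
  have h2 := (hasDerivAt_id (0 : ℂ)).sub_const 2
  have h := ((((hasDerivAt_id (0 : ℂ)).mul hG).add
    ((hp.div (h1.mul h2) (by simp)).const_mul ((x : ℂ) ^ 2))).add
      ((hp.div h1 (by simp)).const_mul (x : ℂ))).add (hp.const_mul (5 / 12 : ℂ))
  refine h.congr_deriv ?_
  simp
  ring

theorem mellin_remainderKernel_zero (x : ℝ) :
    mellin (remainderKernel x) 0 =
      ((∫ t in Ioi 0, exp (-(x * t)) * gammaKernel t / t : ℝ) : ℂ) := by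
  rw [← integral_complex_ofReal]
  refine setIntegral_congr_fun measurableSet_Ioi fun t _ => ?_
  simp only [remainderKernel, smul_eq_mul, zero_sub, Complex.cpow_neg_one]
  push_cast
  ring

theorem integrableOn_exp_mul_gammaKernel_div {x : ℝ} (hx : 0 < x) :
    IntegrableOn (fun t => exp (-(x * t)) * gammaKernel t / t) (Ioi 0) := by
  have h : IntegrableOn (fun t : ℝ => (t : ℂ) ^ ((0 : ℂ) - 1) • remainderKernel x t) (Ioi 0) :=
    mellinConvergent_remainderKernel hx (by simp)
  refine IntegrableOn.congr_fun (f := fun t : ℝ =>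
    ((t : ℂ) ^ ((0 : ℂ) - 1) • remainderKernel x t).re) h.re (fun t _ => ?_) measurableSet_Ioi
  simp only [remainderKernel, smul_eq_mul, zero_sub, Complex.cpow_neg_one]
  rw [← Complex.ofReal_inv, ← Complex.ofReal_mul, Complex.ofReal_re, div_eq_inv_mul]

theorem log_barnesGammaTwo {x : ℝ} (hx : 0 < x) :
    log (barnesGammaTwo x) = (∫ t in Ioi 0, exp (-(x * t)) * gammaKernel t / t) -
      (1 / 2 * x ^ 2 - x + 5 / 12) * log x + 3 / 4 * x ^ 2 - x := by
  rw [barnesGammaTwo, log_exp, (eventually_barnesZetaTwo_eq hx).deriv_eq,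
    (hasDerivAt_mellinZetaTwo_zero hx).deriv, mellin_remainderKernel_zero,
    ← Complex.ofReal_log hx.le]
  set J := ∫ t in Ioi 0, exp (-(x * t)) * gammaKernel t / t
  rw [show (J : ℂ) + x ^ 2 * (3 / 4 - (log x : ℂ) / 2) + x * ((log x : ℂ) - 1) -
    5 / 12 * (log x : ℂ) = ((J + x ^ 2 * (3 / 4 - log x / 2) + x * (log x - 1) -
      5 / 12 * log x : ℝ) : ℂ) by push_cast; rfl, Complex.ofReal_re]
  ring

/-! ### Tonelli's theorem and the representing measure -/

theorem measurable_kernelTerm (a : ℝ) : Measurable (kernelTerm a) := by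
  unfold kernelTerm
  fun_prop

theorem measurable_stieltjesDensity (a : ℝ) : Measurable (stieltjesDensity a) := by
  unfold stieltjesDensity
  fun_prop

theorem lintegral_exp_neg_mul_mul_sq {r : ℝ} (hr : 0 < r) :
    ∫⁻ t in Ioi 0, ENNReal.ofReal (exp (-(r * t)) * (t ^ 2 / 2)) =
      ENNReal.ofReal (1 / r ^ (3 : ℝ)) := by
  have h : ∫ t in Ioi 0, exp (-(r * t)) * (t ^ 2 / 2) = 1 / r ^ (3 : ℝ) := by
    have h3 := integral_rpow_mul_exp_neg_mul_Ioi (a := 3) (by norm_num) hr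
    have hG : Gamma 3 = 2 := by
      norm_num [Nat.factorial]
    rw [hG, one_div, inv_rpow hr.le] at h3
    rw [one_div, ← mul_div_cancel_right₀ (r ^ (3 : ℝ))⁻¹ two_ne_zero, ← h3, ← integral_div]
    refine setIntegral_congr_fun measurableSet_Ioi fun t _ => ?_
    have : t ^ ((3 : ℝ) - 1) = t ^ 2 := by norm_num
    simp only [this]
    ring
  rw [← h, ofReal_integral_eq_lintegral_ofReal]
  -- The Bochner integral of a non-integrable function is 0, so a nonzero value proves
  -- integrability.
  · refine Integrable.of_integral_ne_zero ?_
    rw [h]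
    positivity
  · exact Eventually.of_forall fun t => by positivity

/-- Insert the Gamma integral for (x + u)⁻³, exchange the integrals, and recognise the Laplace
transform of the density in u; its factor 2/t³ meets t²/2 and leaves 1/t. -/
theorem lintegral_stieltjesDensity_div {a x : ℝ} (ha : 2 * π ≤ a) (hx : 0 < x) :
    ∫⁻ u in Ioi 0, ENNReal.ofReal (stieltjesDensity a u) * ENNReal.ofReal (1 / (x + u) ^ (3 : ℝ)) =
      ∫⁻ t in Ioi 0, ENNReal.ofReal (exp (-(x * t)) * kernelTerm a t / t) := by
  have hm := measurable_stieltjesDensity a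
  calc _ = ∫⁻ u in Ioi 0, ∫⁻ t in Ioi 0, ENNReal.ofReal (stieltjesDensity a u) *
        ENNReal.ofReal (exp (-((x + u) * t)) * (t ^ 2 / 2)) := by
        refine setLIntegral_congr_fun measurableSet_Ioi fun u hu => ?_
        rw [lintegral_const_mul' _ _ ENNReal.ofReal_ne_top,
          lintegral_exp_neg_mul_mul_sq (add_pos hx hu)]
    _ = ∫⁻ t in Ioi 0, ∫⁻ u in Ioi 0, ENNReal.ofReal (stieltjesDensity a u) *
        ENNReal.ofReal (exp (-((x + u) * t)) * (t ^ 2 / 2)) := by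
        refine lintegral_lintegral_swap (Measurable.aemeasurable ?_)
        unfold Function.uncurry
        fun_prop
    _ = ∫⁻ t in Ioi 0, ENNReal.ofReal (exp (-(x * t)) * kernelTerm a t / t) := by
        refine setLIntegral_congr_fun measurableSet_Ioi fun t (ht : 0 < t) => ?_
        have he : exp (-(x * t)) * kernelTerm a t / t =
            exp (-(x * t)) * (t ^ 2 / 2) * (2 * kernelTerm a t / t ^ 3) := by
          field_simp
        rw [he, ENNReal.ofReal_mul (by positivity), ← lintegral_exp_mul_stieltjesDensity ha ht,
          ← lintegral_const_mul' _ _ ENNReal.ofReal_ne_top]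
        refine setLIntegral_congr_fun measurableSet_Ioi fun u hu => ?_
        have hu0 := stieltjesDensity_nonneg ha (le_of_lt hu)
        rw [← ENNReal.ofReal_mul hu0, ← ENNReal.ofReal_mul (by positivity)]
        congr 1
        rw [show -((x + u) * t) = -(x * t) + -(t * u) by ring, exp_add]
        ring

/-- The measure on `[0, ∞)` that represents the remainder of `log Γ₂`. -/
noncomputable def gammaTwoMeasure : Measure ℝ :=
  Measure.sum fun k : ℕ => (volume.restrict (Ici 0)).withDensity
    fun u => ENNReal.ofReal (stieltjesDensity (frequency k) u)

/-- Positivity allows the sum over frequencies to be exchanged with the integral. In [0, ∞] this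
needs no convergence, so finiteness on the right yields integrability on the left. -/
theorem lintegral_gammaTwoMeasure {x : ℝ} (hx : 0 < x) :
    ∫⁻ u in Ici 0, ENNReal.ofReal (1 / (x + u) ^ (3 : ℝ)) ∂gammaTwoMeasure =
      ∫⁻ t in Ioi 0, ENNReal.ofReal (exp (-(x * t)) * gammaKernel t / t) := by
  have hk (k : ℕ) : ∫⁻ u in Ici 0, ENNReal.ofReal (1 / (x + u) ^ (3 : ℝ))
      ∂(volume.restrict (Ici 0)).withDensity
        (fun u => ENNReal.ofReal (stieltjesDensity (frequency k) u)) =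
      ∫⁻ t in Ioi 0, ENNReal.ofReal (exp (-(x * t)) * kernelTerm (frequency k) t / t) := by
    rw [restrict_withDensity measurableSet_Ici, Measure.restrict_restrict measurableSet_Ici,
      inter_self, ← restrict_Ioi_eq_restrict_Ici,
      lintegral_withDensity_eq_lintegral_mul _ (measurable_stieltjesDensity _).ennreal_ofReal
        (by fun_prop), ← lintegral_stieltjesDensity_div (two_pi_le_frequency k) hx]
    rfl
  rw [gammaTwoMeasure, Measure.restrict_sum _ measurableSet_Ici, lintegral_sum_measure]
  simp_rw [hk]
  rw [← lintegral_tsum fun k => by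
    have := measurable_kernelTerm (frequency k)
    exact Measurable.aemeasurable (by fun_prop)]
  refine setLIntegral_congr_fun measurableSet_Ioi fun t (ht : 0 < t) => ?_
  have hs := ((hasSum_kernelTerm ht).mul_left (exp (-(x * t)))).div_const t
  rw [← hs.tsum_eq, ENNReal.ofReal_tsum_of_nonneg (fun k => ?_) hs.summable]
  have := kernelTerm_nonneg (frequency k) ht
  positivity

theorem integrableOn_gammaTwoMeasure {x : ℝ} (hx : 0 < x) :
    IntegrableOn (fun u : ℝ => 1 / (x + u) ^ (3 : ℝ)) (Ici 0) gammaTwoMeasure := by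
  refine ⟨Measurable.aestronglyMeasurable (by fun_prop), ?_⟩
  rw [hasFiniteIntegral_iff_ofReal, lintegral_gammaTwoMeasure hx]
  · exact (integrableOn_exp_mul_gammaKernel_div hx).lintegral_lt_top
  · refine (ae_restrict_mem measurableSet_Ici).mono fun u (hu : 0 ≤ u) => ?_
    simp only [Pi.zero_apply]
    positivity

theorem integral_gammaTwoMeasure {x : ℝ} (hx : 0 < x) :
    ∫ u in Ici 0, 1 / (x + u) ^ (3 : ℝ) ∂gammaTwoMeasure =
      ∫ t in Ioi 0, exp (-(x * t)) * gammaKernel t / t := by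
  rw [integral_eq_lintegral_of_nonneg_ae _ (integrableOn_gammaTwoMeasure hx).1,
    integral_eq_lintegral_of_nonneg_ae _ (integrableOn_exp_mul_gammaKernel_div hx).1,
    lintegral_gammaTwoMeasure hx]
  · refine (ae_restrict_mem measurableSet_Ioi).mono fun t (ht : 0 < t) => ?_
    have := gammaKernel_nonneg ht
    simp only [Pi.zero_apply]
    positivity
  · refine (ae_restrict_mem measurableSet_Ici).mono fun u (hu : 0 ≤ u) => ?_
    simp only [Pi.zero_apply]
    positivity

end

theorem mainTheorem9 :
    (fun x : ℝ => Real.log (barnesGammaTwo x) + (1 / 2 * x ^ 2 - x + 5 / 12) * Real.log x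
      - 3 / 4 * x ^ 2 + x) ∈ generalizedStieltjes 3 := by
  refine ⟨gammaTwoMeasure, 0, le_rfl, fun x hx => ⟨integrableOn_gammaTwoMeasure hx, ?_⟩⟩
  beta_reduce
  rw [integral_gammaTwoMeasure hx, log_barnesGammaTwo hx]
  ring
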